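/- Let $F$ be a subfield of $\mathbb R$. For $K\subseteq\mathbb R$ let $Pos(K)=\{f\in F[x] : f\ge 0 \text{ on } K\}$. For $S\subseteq F[x]$ let $K_S=\{x\in\mathbb R : g(x)\ge 0 \text{ for all } g\in S\}$, and let $T_S\subseteq F[x]$ be the preordering generated by $S$, i.e. the set of all finite sums of terms $a\,p^2\,g_1\cdots g_k$ with $a\in F$, $a\ge 0$, $p\in F[x]$, $k\ge 0$ and $g_1,\dots,g_k\in S$ distinct. A subset of $F[x]$ is a finitely generated preordering if it equals $T_S$ for some finite $S\subseteq F[x]$. Let $C_0=[0,1]$, let $C_{n+1}=\tfrac13 C_n\cup\left(\tfrac23+\tfrac13 C_n\right)$ for $n\ge 0$, and let $C=\bigcap_{n\ge 0}C_n$ be the Cantor set. Let $\mathcal N_n\subseteq F[x]$ be the natural choice of generators of $C_n$, consisting of the following polynomials: $x-a$ if $a\in\partial C_n$ and $(-\infty,a)\cap C_n=\emptyset$; $a-x$ if $a\in\partial C_n$ and $(a,\infty)\cap C_n=\emptyset$; and $(x-a)(x-b)$ if $a,b\in\partial C_n$, $a<b$ and $(a,b)\cap C_n=\emptyset$. Then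 for every $n\ge 0$ we have $\partial C_n\subset F$, the set $\mathcal N_n$ is finite and $C_n=K_{\mathcal N_n}$ is basic closed semi-algebraic; moreover $$Pos(C)=\bigcup_{n\ge 0}Pos(C_n)=\bigcup_{n\ge 0}T_{\mathcal N_n}.$$ In particular, $Pos(C)$ is not a finitely generated preordering, i.e. $Pos(C)\ne T_S$ for every finite $S\subseteq F[x]$. -/

import Mathlib

open Polynomial

namespace RealPos

/-- `Pos(K)`: the polynomials over the subfield `F` of `ℝ` that are nonnegative on `K ⊆ ℝ`. -/
def Pos (F : Subfield ℝ) (K : Set ℝ) : Set F[X] :=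
  {f | ∀ x ∈ K, 0 ≤ aeval x f}

/-- `K_S`: the closed set defined by the inequalities `g ≥ 0`, `g ∈ S`. -/
def basicClosed (F : Subfield ℝ) (S : Set F[X]) : Set ℝ :=
  {x | ∀ g ∈ S, 0 ≤ aeval x g}

/-- `T_S = ∑_e F_{≥0} F[x]² g^e`, the preordering of `F[x]` generated by `S`: all finite sums of
terms `a p² g^e` with `a ∈ F`, `a ≥ 0`, `p ∈ F[x]`, and `g^e` the product of the elements of a
finite subset `e` of `S` (the empty product being `1`). -/
noncomputable def preordering (F : Subfield ℝ) (S : Set F[X]) : AddSubmonoid F[X] :=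
  AddSubmonoid.closure
    {f | ∃ (a : F) (p : F[X]) (e : Finset F[X]),
      0 ≤ (a : ℝ) ∧ (e : Set F[X]) ⊆ S ∧ f = C a * p ^ 2 * ∏ g ∈ e, g}

/-- A subset of `F[x]` is a finitely generated preordering if it is `T_S` for a finite `S`. -/
def IsFGPreordering (F : Subfield ℝ) (P : Set F[X]) : Prop :=
  ∃ S : Set F[X], S.Finite ∧ P = preordering F S

/-- The natural choice of generators of `K`, for `K` a nonempty finite union of closed intervals
with boundary in `F`. -/
noncomputable def naturalGenerators (F : Subfield ℝ) (K : Set ℝ) : Set F[X] :=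
  {g | (∃ a : F, (a : ℝ) ∈ frontier K ∧ Set.Iio (a : ℝ) ∩ K = ∅ ∧ g = X - C a) ∨
    (∃ a : F, (a : ℝ) ∈ frontier K ∧ Set.Ioi (a : ℝ) ∩ K = ∅ ∧ g = C a - X) ∨
    (∃ a b : F, (a : ℝ) ∈ frontier K ∧ (b : ℝ) ∈ frontier K ∧ (a : ℝ) < b ∧
      Set.Ioo (a : ℝ) b ∩ K = ∅ ∧ g = (X - C a) * (X - C b)) ∨
    (K = Set.univ ∧ g = 1)}

end RealPos

/-! Two facts carry the theorem: each `T_{N_n}` is saturated, and nonnegativity on `C` spreads to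
some `C_n`.

Saturation (`preordering_naturalGenerators`). A polynomial strictly positive on `K = C_n` lies in
the preordering: subtracting weighted squares `g p²` of the generators makes it positive on `[0,
1]`, where its Bernstein coefficients of high degree are positive. Zeros on `K` are divided out. An
interior zero gives the square of its minimal polynomial; zeros at `0` and `1` give `x` and `1 - x`;
zeros at both ends of a gap give a natural generator. The delicate case, a zero at only one end of a
gap, is `exists_decomposition`: up to a positive multiple of a square, the zero is traded for a
factor without zeros on `K`.

Spreading (`Pos_cantorSet`). Near `c ∈ C` a nonzero `f` has one sign on each side. If `C`
accumulates at `c` from that side, the sign is positive; if not, some `C_n` has no points on that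
side near `c`, because boundary points of `C_n` stay in `C`. Compactness makes `n` uniform.

Finite generation fails because finitely many generators are already nonnegative on some `C_N`,
while `Pos(C)` contains polynomials that cut out the smaller set `C_{N+1}`. -/

namespace RealPos

open Set Filter Topology

variable {F : Subfield ℝ} {K : Set ℝ}

/-! ### Arithmetic of preorderings -/

theorem mem_preordering_of_mem {S : Set F[X]} {g : F[X]} (hg : g ∈ S) : g ∈ preordering F S :=
  AddSubmonoid.subset_closure ⟨1, 1, {g}, by simp, by simpa using hg, by simp⟩

theorem C_mul_sq_mem_preordering (S : Set F[X]) {a : F} (ha : 0 ≤ (a : ℝ)) (p : F[X]) :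
    C a * p ^ 2 ∈ preordering F S :=
  AddSubmonoid.subset_closure ⟨a, p, ∅, ha, by simp, by simp⟩

theorem C_mem_preordering (S : Set F[X]) {a : F} (ha : 0 ≤ (a : ℝ)) :
    C a ∈ preordering F S := by
  simpa using C_mul_sq_mem_preordering S ha 1

theorem sq_mem_preordering (S : Set F[X]) (p : F[X]) : p ^ 2 ∈ preordering F S := by
  simpa using C_mul_sq_mem_preordering S (a := 1) (by simp) p

theorem mul_mem_preordering {S : Set F[X]} {f g : F[X]} (hf : f ∈ preordering F S)
    (hg : g ∈ preordering F S) : f * g ∈ preordering F S := by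
  classical
  induction hf using AddSubmonoid.closure_induction with
  | zero => simp
  | add x y _ _ hx hy => rw [add_mul]; exact add_mem hx hy
  | mem f hf =>
    obtain ⟨a, p, e, ha, he, rfl⟩ := hf
    induction hg using AddSubmonoid.closure_induction with
    | zero => simp
    | add x y _ _ hx hy => rw [mul_add]; exact add_mem hx hy
    | mem g hg =>
      obtain ⟨b, q, e', hb, he', rfl⟩ := hg
      -- Generators common to `e` and `e'` occur twice, so they move into the square; the symmetric
      -- difference remains.
      refine AddSubmonoid.subset_closure
        ⟨a * b, p * q * ∏ g ∈ e ∩ e', g, (e \ e') ∪ (e' \ e), ?_, ?_, ?_⟩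
      · simpa using mul_nonneg ha hb
      · intro x hx
        simp only [Finset.coe_union, Finset.coe_sdiff] at hx
        rcases hx with hx | hx
        · exact he hx.1
        · exact he' hx.1
      · have hd : Disjoint (e \ e') (e' \ e) := disjoint_sdiff_sdiff
        rw [Finset.prod_union hd]
        have h1 := Finset.prod_inter_mul_prod_sdiff e e' (fun g : F[X] => g)
        have h2 := Finset.prod_inter_mul_prod_sdiff e' e (fun g : F[X] => g)
        rw [Finset.inter_comm] at h2
        rw [← h1, ← h2, C_mul]
        ring

theorem pow_mem_preordering {S : Set F[X]} {f : F[X]} (hf : f ∈ preordering F S) (n : ℕ) :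
    f ^ n ∈ preordering F S := by
  induction n with
  | zero => simpa using sq_mem_preordering S 1
  | succ n ih => rw [pow_succ]; exact mul_mem_preordering ih hf

theorem aeval_C_coe (a : F) (x : ℝ) : aeval x (C a : F[X]) = (a : ℝ) := by
  rw [aeval_C]; rfl

theorem preordering_subset_Pos {S : Set F[X]} {K : Set ℝ} (hS : S ⊆ Pos F K) :
    (preordering F S : Set F[X]) ⊆ Pos F K := by
  intro f hf x hx
  induction hf using AddSubmonoid.closure_induction with
  | zero => simp
  | add f g _ _ h1 h2 => rw [map_add]; exact add_nonneg h1 h2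
  | mem f hf =>
    obtain ⟨a, p, e, ha, he, rfl⟩ := hf
    rw [map_mul, map_mul, map_pow, map_prod, aeval_C_coe]
    exact mul_nonneg (mul_nonneg ha (sq_nonneg _))
      (Finset.prod_nonneg fun g hg => hS (he hg) x hx)

/-! ### Strict positivity on the unit interval -/

theorem bernsteinPolynomial_mul_X (N k : ℕ) :
    bernsteinPolynomial F N k * X =
      C (((k + 1 : ℕ) : F) / ((N + 1 : ℕ) : F)) * bernsteinPolynomial F (N + 1) (k + 1) := by
  have h : ((N + 1 : ℕ) : F) ≠ 0 := by exact_mod_cast Nat.succ_ne_zero N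
  have h1 : ((N + 1).choose (k + 1) : F) * ((k + 1 : ℕ) : F) = ((N + 1 : ℕ) : F) * N.choose k := by
    exact_mod_cast (Nat.add_one_mul_choose_eq N k).symm
  have h2 : ((k + 1 : ℕ) : F) / ((N + 1 : ℕ) : F) * ((N + 1).choose (k + 1) : F) = N.choose k := by
    rw [div_mul_eq_mul_div, mul_comm, h1, mul_div_cancel_left₀ _ h]
  have h3 : C (((k + 1 : ℕ) : F) / ((N + 1 : ℕ) : F)) * (((N + 1).choose (k + 1) : ℕ) : F[X])
      = ((N.choose k : ℕ) : F[X]) := by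
    rw [← C_eq_natCast, ← C_eq_natCast, ← C_mul, h2]
  simp only [bernsteinPolynomial, Nat.succ_sub_succ_eq_sub]
  rw [← mul_assoc, ← mul_assoc, h3]
  ring

/-- Coefficients close to the values at `k / N` become positive when `p` is positive on `[0, 1]`.
The induction multiplies by `X`, which shifts the index and rescales by `k / (N + 1)`; uniform
continuity absorbs the move of the nodes. -/
theorem bernstein_coefficients_approx (p : F[X]) :
    ∀ ε : ℝ, 0 < ε → ∃ N₀ : ℕ, ∀ N ≥ N₀, ∃ b : ℕ → F,
      p = ∑ k ∈ Finset.range (N + 1), C (b k) * bernsteinPolynomial F N k ∧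
      ∀ k ≤ N, |(b k : ℝ) - aeval ((k : ℝ) / N) p| ≤ ε := by
  induction p using Polynomial.induction_on with
  | C a =>
    intro ε hε
    refine ⟨0, fun N _ => ⟨fun _ => a, ?_, fun k _ => ?_⟩⟩
    · rw [← Finset.mul_sum, bernsteinPolynomial.sum, mul_one]
    · rw [aeval_C_coe, sub_self, abs_zero]; exact hε.le
  | add p q hp hq =>
    intro ε hε
    obtain ⟨N₁, h1⟩ := hp (ε / 2) (by positivity)
    obtain ⟨N₂, h2⟩ := hq (ε / 2) (by positivity)
    refine ⟨max N₁ N₂, fun N hN => ?_⟩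
    obtain ⟨b, hb, hb'⟩ := h1 N (le_trans (le_max_left _ _) hN)
    obtain ⟨c, hc, hc'⟩ := h2 N (le_trans (le_max_right _ _) hN)
    refine ⟨fun k => b k + c k, ?_, fun k hk => ?_⟩
    · simp only [C_add, add_mul, Finset.sum_add_distrib]
      rw [← hb, ← hc]
    · have e : ((b k + c k : F) : ℝ) - aeval ((k : ℝ) / N) (p + q)
          = ((b k : ℝ) - aeval ((k : ℝ) / N) p) + ((c k : ℝ) - aeval ((k : ℝ) / N) q) := by
        rw [map_add]; push_cast; ring
      rw [e]
      exact (abs_add_le _ _).trans (by linarith [hb' k hk, hc' k hk])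
  | monomial n a hp =>
    intro ε hε
    rw [pow_succ, ← mul_assoc]
    set p : F[X] := C a * X ^ n with hpdef
    obtain ⟨N₁, h1⟩ := hp (ε / 2) (by positivity)
    have hu : UniformContinuousOn (fun x : ℝ => aeval x p) (Set.Icc 0 1) :=
      isCompact_Icc.uniformContinuousOn_of_continuous (Polynomial.continuous_aeval p).continuousOn
    obtain ⟨δ, hδ, hu⟩ := Metric.uniformContinuousOn_iff.mp hu (ε / 2) (by positivity)
    obtain ⟨N₂, h2⟩ := exists_nat_one_div_lt hδ
    refine ⟨max (N₁ + 2) (N₂ + 2), fun N' hN' => ?_⟩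
    obtain ⟨N, rfl⟩ : ∃ N, N' = N + 1 := ⟨N' - 1, by omega⟩
    obtain ⟨b, hb, hb'⟩ := h1 N (by omega)
    -- At `k = 0` the truncated `k - 1` is harmless, since the factor in front is zero.
    refine ⟨fun k => ((k : ℕ) : F) / ((N + 1 : ℕ) : F) * b (k - 1), ?_, fun k hk => ?_⟩
    · rw [Finset.sum_range_succ' _ (N + 1)]
      conv_lhs => rw [hb, Finset.sum_mul]
      simp only [Nat.cast_zero, zero_div, zero_mul, C_0, add_zero, Nat.add_sub_cancel]
      refine Finset.sum_congr rfl fun k _ => ?_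
      rw [mul_assoc, bernsteinPolynomial_mul_X, C_mul]
      ring
    · rcases Nat.eq_zero_or_pos k with rfl | hk0
      · simpa using hε.le
      obtain ⟨j, rfl⟩ : ∃ j, k = j + 1 := ⟨k - 1, by omega⟩
      have hjN : j ≤ N := by omega
      have hN0 : (0 : ℝ) < N := by
        have : 0 < N := by omega
        exact_mod_cast this
      have hjN' : (j : ℝ) ≤ N := by exact_mod_cast hjN
      have hN2 : (N₂ : ℝ) + 1 ≤ N := by
        have : N₂ + 1 ≤ N := by omega
        exact_mod_cast this
      have hB := hb' j hjN
      set y : ℝ := ((j + 1 : ℕ) : ℝ) / ((N + 1 : ℕ) : ℝ) with hy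
      have hy0 : 0 ≤ y := by positivity
      have hy1 : y ≤ 1 := by
        rw [hy, div_le_one (by positivity)]; push_cast; linarith
      have hz0 : 0 ≤ (j : ℝ) / N := by positivity
      have hz1 : (j : ℝ) / N ≤ 1 := by rw [div_le_one hN0]; exact hjN'
      have hd : |(j : ℝ) / N - y| < δ := by
        have e : (j : ℝ) / N - y = -((N - j) / N * (1 / (N + 1))) := by
          rw [hy]; push_cast; field_simp; ring
        have h3 : ((N : ℝ) - j) / N ≤ 1 := by
          rw [div_le_one hN0]; linarith [Nat.cast_nonneg (α := ℝ) j]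
        have h4 : 0 ≤ ((N : ℝ) - j) / N := div_nonneg (by linarith) hN0.le
        have h5 : (1 : ℝ) / (N + 1) ≤ 1 / (N₂ + 1) :=
          one_div_le_one_div_of_le (by positivity) (by linarith)
        rw [e, abs_neg, abs_of_nonneg (mul_nonneg h4 (by positivity))]
        calc ((N : ℝ) - j) / N * (1 / (N + 1)) ≤ 1 * (1 / (N + 1)) := by gcongr
          _ < δ := by rw [one_mul]; exact lt_of_le_of_lt h5 h2
      have hU := hu _ ⟨hz0, hz1⟩ _ ⟨hy0, hy1⟩ hd
      rw [Real.dist_eq] at hU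
      have e : ((((j + 1 : ℕ) : F) / ((N + 1 : ℕ) : F) * b (j + 1 - 1) : F) : ℝ)
          - aeval y (p * X) = y * (((b j : ℝ) - aeval ((j : ℝ) / N) p) +
            (aeval ((j : ℝ) / N) p - aeval y p)) := by
        rw [map_mul, aeval_X, Nat.add_sub_cancel, hy]; push_cast; ring
      rw [e, abs_mul, abs_of_nonneg hy0]
      calc y * |((b j : ℝ) - aeval ((j : ℝ) / N) p) + (aeval ((j : ℝ) / N) p - aeval y p)|
          ≤ 1 * (ε / 2 + ε / 2) := by
            gcongr
            exact (abs_add_le _ _).trans (add_le_add hB hU.le)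
        _ = ε := by ring

theorem exists_pos_forall_le_of_isCompact {K : Set ℝ} (hK : IsCompact K) {f : ℝ → ℝ}
    (hf : ContinuousOn f K) (hpos : ∀ x ∈ K, 0 < f x) : ∃ δ > 0, ∀ x ∈ K, δ ≤ f x := by
  rcases K.eq_empty_or_nonempty with rfl | hne
  · exact ⟨1, one_pos, by simp⟩
  · obtain ⟨x, hx, hmin⟩ := hK.exists_isMinOn hne hf
    exact ⟨f x, hpos x hx, fun y hy => hmin hy⟩

theorem mem_preordering_of_pos_on_Icc {S : Set F[X]} (hX : X ∈ preordering F S)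
    (hX' : 1 - X ∈ preordering F S) {q : F[X]} (hq : ∀ x ∈ Set.Icc (0 : ℝ) 1, 0 < aeval x q) :
    q ∈ preordering F S := by
  obtain ⟨δ, hδ, hle⟩ := exists_pos_forall_le_of_isCompact isCompact_Icc
    (Polynomial.continuous_aeval q).continuousOn hq
  obtain ⟨N, hN⟩ := bernstein_coefficients_approx q δ hδ
  obtain ⟨b, hb, hb'⟩ := hN N le_rfl
  rw [hb]
  refine sum_mem fun k hk => mul_mem_preordering (C_mem_preordering S ?_) ?_
  · have hkN : k ≤ N := by simpa [Nat.lt_succ_iff] using hk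
    have h1 := hle ((k : ℝ) / N) ⟨by positivity,
      div_le_one_of_le₀ (by exact_mod_cast hkN) (by positivity)⟩
    have h2 := abs_le.mp (hb' k hkN)
    linarith [h2.1]
  · unfold bernsteinPolynomial
    rw [← C_eq_natCast]
    exact mul_mem_preordering (mul_mem_preordering (C_mem_preordering S (by simp))
      (pow_mem_preordering hX _)) (pow_mem_preordering hX' _)

/-! ### Approximation over `F` and strict positivity on basic closed sets -/

/-- `F` contains `ℚ`, so real coefficients can be perturbed to rational ones; monomials are at most
`1` on `[0, 1]`. -/
theorem exists_aeval_near_eval (P : ℝ[X]) : ∀ ε : ℝ, 0 < ε →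
    ∃ p : F[X], ∀ x ∈ Set.Icc (0 : ℝ) 1, |aeval x p - P.eval x| < ε := by
  induction P using Polynomial.induction_on' with
  | add P Q hP hQ =>
    intro ε hε
    obtain ⟨p, hp⟩ := hP (ε / 2) (by positivity)
    obtain ⟨q, hq⟩ := hQ (ε / 2) (by positivity)
    refine ⟨p + q, fun x hx => ?_⟩
    have e : aeval x (p + q) - (P + Q).eval x
        = (aeval x p - P.eval x) + (aeval x q - Q.eval x) := by
      rw [map_add, eval_add]; ring
    rw [e]
    exact (abs_add_le _ _).trans_lt (by linarith [hp x hx, hq x hx])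
  | monomial n c =>
    intro ε hε
    obtain ⟨r, hr1, hr2⟩ := exists_rat_btwn (show c < c + ε by linarith)
    refine ⟨C (r : F) * X ^ n, fun x hx => ?_⟩
    have h1 : |x ^ n| ≤ 1 := by
      rw [abs_of_nonneg (pow_nonneg hx.1 n)]; exact pow_le_one₀ hx.1 hx.2
    rw [map_mul, aeval_C_coe, map_pow, aeval_X, eval_monomial]
    have e : (((r : F) : ℝ)) * x ^ n - c * x ^ n = (r - c) * x ^ n := by push_cast; ring
    rw [e, abs_mul, abs_of_pos (by linarith)]
    calc ((r : ℝ) - c) * |x ^ n| ≤ (r - c) * 1 := by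
          gcongr
      _ < ε := by linarith

theorem exists_aeval_near {φ : ℝ → ℝ} (hφ : Continuous φ) {ε : ℝ} (hε : 0 < ε) :
    ∃ p : F[X], ∀ x ∈ Set.Icc (0 : ℝ) 1, |aeval x p - φ x| < ε := by
  obtain ⟨P, hP⟩ := exists_polynomial_near_of_continuousOn 0 1 φ hφ.continuousOn (ε / 2)
    (by positivity)
  obtain ⟨p, hp⟩ := exists_aeval_near_eval (F := F) P (ε / 2) (by positivity)
  refine ⟨p, fun x hx => ?_⟩
  have := abs_add_le (aeval x p - P.eval x) (P.eval x - φ x)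
  rw [sub_add_sub_cancel] at this
  linarith [hP x hx, hp x hx]

theorem exists_mul_sq_near (g : F[X]) {φ : ℝ → ℝ} (hφ : Continuous φ) {ε : ℝ} (hε : 0 < ε) :
    ∃ p : F[X], ∀ x ∈ Set.Icc (0 : ℝ) 1, |aeval x (g * p ^ 2) - aeval x g * φ x ^ 2| < ε := by
  obtain ⟨M, hM⟩ := isCompact_Icc.exists_bound_of_continuousOn (s := Set.Icc (0 : ℝ) 1)
    (Polynomial.continuous_aeval g).continuousOn
  obtain ⟨B, hB⟩ := isCompact_Icc.exists_bound_of_continuousOn (s := Set.Icc (0 : ℝ) 1)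
    hφ.continuousOn
  have hM0 : 0 ≤ M := (norm_nonneg _).trans (hM 0 ⟨le_rfl, zero_le_one⟩)
  have hB0 : 0 ≤ B := (norm_nonneg _).trans (hB 0 ⟨le_rfl, zero_le_one⟩)
  have hD : 0 < (M + 1) * (2 * B + 1) := by positivity
  -- The bound `1` keeps `|p + φ| ≤ 2B + 1` in the factorization `p² - φ² = (p + φ)(p - φ)`.
  obtain ⟨p, hp⟩ := exists_aeval_near (F := F) hφ (ε := min 1 (ε / ((M + 1) * (2 * B + 1))))
    (lt_min one_pos (by positivity))
  refine ⟨p, fun x hx => ?_⟩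
  have h1 := lt_of_lt_of_le (hp x hx) (min_le_left _ _)
  have h2 := lt_of_lt_of_le (hp x hx) (min_le_right _ _)
  have h3 : |aeval x g| ≤ M := hM x hx
  have h4 : |φ x| ≤ B := hB x hx
  have h5 : |aeval x p + φ x| ≤ 2 * B + 1 := by
    have e : aeval x p + φ x = (aeval x p - φ x) + 2 * φ x := by ring
    rw [e]
    refine (abs_add_le _ _).trans ?_
    rw [abs_mul, abs_two]; linarith
  have e : aeval x (g * p ^ 2) - aeval x g * φ x ^ 2
      = aeval x g * (aeval x p + φ x) * (aeval x p - φ x) := by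
    rw [map_mul, map_pow]; ring
  rw [e, abs_mul, abs_mul]
  rw [lt_div_iff₀ hD] at h2
  calc |aeval x g| * |aeval x p + φ x| * |aeval x p - φ x|
      ≤ ((M + 1) * (2 * B + 1)) * |aeval x p - φ x| := by
        gcongr; linarith
    _ < ε := by linarith

/-- If `q` is positive where the nonnegative function `w` vanishes, then `q + k w` is positive
for large `k`. -/
theorem exists_nat_add_mul_pos {K : Set ℝ} (hK : IsCompact K) {q w : ℝ → ℝ} (hq : Continuous q)
    (hw : Continuous w) (hw0 : ∀ x ∈ K, 0 ≤ w x) (h : ∀ x ∈ K, w x = 0 → 0 < q x) :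
    ∃ k : ℕ, ∀ x ∈ K, 0 < q x + k * w x := by
  have hL : IsCompact (K ∩ {x | q x ≤ 0}) := hK.inter_right (isClosed_le hq continuous_const)
  obtain ⟨δ, hδ, hle⟩ := exists_pos_forall_le_of_isCompact hL hw.continuousOn (by
    rintro x ⟨hx, hx'⟩
    refine lt_of_le_of_ne (hw0 x hx) fun h0 => ?_
    exact absurd (h x hx h0.symm) (not_lt.mpr hx'))
  obtain ⟨M, hM⟩ := hK.exists_bound_of_continuousOn hq.continuousOn
  obtain ⟨k, hk⟩ := exists_nat_gt (M / δ)
  refine ⟨k, fun x hx => ?_⟩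
  rcases lt_or_ge 0 (q x) with hx0 | hx0
  · have := mul_nonneg (Nat.cast_nonneg (α := ℝ) k) (hw0 x hx)
    linarith
  · have h1 := hle x ⟨hx, hx0⟩
    have h2 : |q x| ≤ M := hM x hx
    rw [div_lt_iff₀ hδ] at hk
    have h3 : (k : ℝ) * δ ≤ k * w x := by gcongr
    linarith [(abs_le.mp h2).1]

/-- A finitely generated preordering that contains `x` and `1 - x` contains every polynomial that
is positive on the associated basic closed set. -/
theorem mem_preordering_of_pos {S : Set F[X]} (hS : S.Finite) (hX : X ∈ preordering F S)
    (hX' : 1 - X ∈ preordering F S) {q : F[X]} (hq : ∀ x ∈ basicClosed F S, 0 < aeval x q) :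
    q ∈ preordering F S := by
  classical
  -- With `φ g` the negative part of `g`, `g φ² = -φ³` is nonzero exactly where `g < 0`. Hence `q -
  -- k ∑ g φ²` raises `q` only outside the basic closed set, and large `k` makes it positive on `[0,
  -- 1]`.
  let φ : F[X] → ℝ → ℝ := fun g x => max 0 (-aeval x g)
  have hφ : ∀ g, Continuous (φ g) := fun g => continuous_const.max (Polynomial.continuous_aeval g).neg
  have hφ3 : ∀ g x, aeval x g * φ g x ^ 2 = -φ g x ^ 3 := by
    intro g x
    simp only [φ]
    rcases max_cases 0 (-aeval x g) with h | h <;> rw [h.1] <;> ring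
  let w : ℝ → ℝ := fun x => ∑ g ∈ hS.toFinset, φ g x ^ 3
  have hφ0 : ∀ g x, 0 ≤ φ g x := fun g x => le_max_left _ _
  obtain ⟨k, hk⟩ := exists_nat_add_mul_pos (K := Set.Icc (0 : ℝ) 1) isCompact_Icc
    (Polynomial.continuous_aeval q) (w := w) (continuous_finsetSum _ fun g _ => (hφ g).pow 3)
    (fun x _ => Finset.sum_nonneg fun g _ => pow_nonneg (hφ0 g x) 3) (by
      intro x _ hwx
      refine hq x fun g hg => ?_
      have h1 := (Finset.sum_eq_zero_iff_of_nonneg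
        (fun g _ => pow_nonneg (hφ0 g x) 3)).mp hwx g (hS.mem_toFinset.mpr hg)
      have h2 : φ g x = 0 := by simpa using h1
      have h3 : -aeval x g ≤ φ g x := le_max_right _ _
      linarith)
  obtain ⟨δ, hδ, hle⟩ := exists_pos_forall_le_of_isCompact isCompact_Icc
    (f := fun x => aeval x q + k * w x) (by
      refine ((Polynomial.continuous_aeval q).add (continuous_const.mul ?_)).continuousOn
      exact continuous_finsetSum _ fun g _ => (hφ g).pow 3) hk
  -- The two `+ 1` keep `D` positive and make `k * card / D < 1`, so the total approximation error
  -- stays below `δ`.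
  let D : ℝ := (k + 1) * (hS.toFinset.card + 1)
  have hD : 0 < D := by positivity
  choose p hp using fun g => exists_mul_sq_near g (hφ g) (ε := δ / D) (by positivity)
  let t : F[X] := ∑ g ∈ hS.toFinset, g * p g ^ 2
  have ht : C (k : F) * t ∈ preordering F S := by
    refine mul_mem_preordering (C_mem_preordering S (by simp)) (sum_mem fun g hg => ?_)
    exact mul_mem_preordering (mem_preordering_of_mem (hS.mem_toFinset.mp hg))
      (sq_mem_preordering S _)
  have hr : q - C (k : F) * t ∈ preordering F S := by
    refine mem_preordering_of_pos_on_Icc hX hX' fun x hx => ?_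
    have h1 := hle x hx
    have h2 : aeval x t + w x ≤ hS.toFinset.card * (δ / D) := by
      have e : aeval x t + w x =
          ∑ g ∈ hS.toFinset, (aeval x (g * p g ^ 2) - aeval x g * φ g x ^ 2) := by
        simp only [t, w, map_sum]
        rw [← Finset.sum_add_distrib]
        refine Finset.sum_congr rfl fun g _ => ?_
        rw [hφ3]; ring
      rw [e, ← nsmul_eq_mul]
      exact Finset.sum_le_card_nsmul _ _ _ fun g _ => (abs_lt.mp (hp g x hx)).2.le
    have h3 : (k : ℝ) * (aeval x t + w x) < δ := by
      calc (k : ℝ) * (aeval x t + w x) ≤ k * (hS.toFinset.card * (δ / D)) := by gcongr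
        _ = (k * hS.toFinset.card) / D * δ := by ring
        _ < 1 * δ := by
          gcongr
          rw [div_lt_one hD]
          simp only [D]
          have := Nat.cast_nonneg (α := ℝ) k
          have := Nat.cast_nonneg (α := ℝ) hS.toFinset.card
          nlinarith
        _ = δ := one_mul δ
    rw [map_sub, map_mul, aeval_C_coe]
    push_cast
    linarith
  have := add_mem hr ht
  rwa [sub_add_cancel] at this

/-! ### Interval unions, gaps and natural generators -/

/-- `K ⊆ [0, 1]` is a finite union of nondegenerate compact intervals with endpoints in `F`,
among which are `0` and `1`. -/
structure IsIntervalUnion (F : Subfield ℝ) (K : Set ℝ) : Prop where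
  isClosed : IsClosed K
  subset_Icc : K ⊆ Icc 0 1
  zero_mem : (0 : ℝ) ∈ K
  one_mem : (1 : ℝ) ∈ K
  finite_frontier : (frontier K).Finite
  frontier_subset : frontier K ⊆ (F : Set ℝ)
  preperfect : Preperfect K

theorem exists_frontier_lt {y z : ℝ} (hK : IsClosed K) (hz : z ∈ K) (hzy : z ≤ y) (hy : y ∉ K) :
    ∃ a ∈ frontier K, z ≤ a ∧ a < y ∧ ∀ x ∈ K, x < y → x ≤ a := by
  have hbdd : BddAbove (K ∩ Iic y) := ⟨y, fun x hx => hx.2⟩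
  have hmem : sSup (K ∩ Iic y) ∈ K ∩ Iic y :=
    (hK.inter isClosed_Iic).csSup_mem ⟨z, hz, hzy⟩ hbdd
  set a := sSup (K ∩ Iic y)
  have hay : a < y := lt_of_le_of_ne hmem.2 fun h => hy (h ▸ hmem.1)
  have hle : ∀ x ∈ K, x < y → x ≤ a := fun x hx hxy => le_csSup hbdd ⟨hx, hxy.le⟩
  -- If `a` were interior, `K` would have points between `a` and `y`, beyond the supremum.
  refine ⟨a, ⟨subset_closure hmem.1, fun hint => ?_⟩, le_csSup hbdd ⟨hz, hzy⟩, hay, hle⟩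
  have h1 : ∀ᶠ x in 𝓝[>] a, x ∈ K := mem_nhdsWithin_of_mem_nhds (mem_interior_iff_mem_nhds.mp hint)
  have h2 : ∀ᶠ x in 𝓝[>] a, x ∈ Ioo a y := Ioo_mem_nhdsGT hay
  obtain ⟨x, hx, hx'⟩ := (h1.and h2).exists
  exact absurd (hle x hx hx'.2) (not_le.mpr hx'.1)

theorem exists_frontier_gt {y z : ℝ} (hK : IsClosed K) (hz : z ∈ K) (hzy : y ≤ z) (hy : y ∉ K) :
    ∃ b ∈ frontier K, b ≤ z ∧ y < b ∧ ∀ x ∈ K, y < x → b ≤ x := by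
  have hbdd : BddBelow (K ∩ Ici y) := ⟨y, fun x hx => hx.2⟩
  have hmem : sInf (K ∩ Ici y) ∈ K ∩ Ici y :=
    (hK.inter isClosed_Ici).csInf_mem ⟨z, hz, hzy⟩ hbdd
  set b := sInf (K ∩ Ici y)
  have hyb : y < b := lt_of_le_of_ne hmem.2 fun h => hy (h.symm ▸ hmem.1)
  have hle : ∀ x ∈ K, y < x → b ≤ x := fun x hx hxy => csInf_le hbdd ⟨hx, hxy.le⟩
  refine ⟨b, ⟨subset_closure hmem.1, fun hint => ?_⟩, csInf_le hbdd ⟨hz, hzy⟩, hyb, hle⟩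
  have h1 : ∀ᶠ x in 𝓝[<] b, x ∈ K := mem_nhdsWithin_of_mem_nhds (mem_interior_iff_mem_nhds.mp hint)
  have h2 : ∀ᶠ x in 𝓝[<] b, x ∈ Ioo y b := Ioo_mem_nhdsLT hyb
  obtain ⟨x, hx, hx'⟩ := (h1.and h2).exists
  exact absurd (hle x hx hx'.1) (not_le.mpr hx'.2)

theorem aeval_X_sub_C_coe (a : F) (x : ℝ) : aeval x (X - C a : F[X]) = x - a := by
  rw [map_sub, aeval_X, aeval_C_coe]

theorem naturalGenerators_subset_Pos (F : Subfield ℝ) (K : Set ℝ) :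
    naturalGenerators F K ⊆ Pos F K := by
  rintro g (⟨a, -, h, rfl⟩ | ⟨a, -, h, rfl⟩ | ⟨a, b, -, -, hab, h, rfl⟩ | ⟨-, rfl⟩) x hx
  · rw [aeval_X_sub_C_coe, sub_nonneg]
    by_contra hlt
    exact (h ▸ (⟨not_le.mp hlt, hx⟩ : x ∈ Iio (a : ℝ) ∩ K) : x ∈ (∅ : Set ℝ))
  · rw [map_sub, aeval_X, aeval_C_coe, sub_nonneg]
    by_contra hlt
    exact (h ▸ (⟨not_le.mp hlt, hx⟩ : x ∈ Ioi (a : ℝ) ∩ K) : x ∈ (∅ : Set ℝ))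
  · rw [map_mul, aeval_X_sub_C_coe, aeval_X_sub_C_coe]
    by_contra hlt
    refine (h ▸ (⟨⟨?_, ?_⟩, hx⟩ : x ∈ Ioo (a : ℝ) b ∩ K) : x ∈ (∅ : Set ℝ)) <;> nlinarith
  · simp

theorem finite_naturalGenerators (hK : (frontier K).Finite) : (naturalGenerators F K).Finite := by
  have hA : {a : F | (a : ℝ) ∈ frontier K}.Finite := hK.preimage Subtype.val_injective.injOn
  refine Set.Finite.subset (((hA.image fun a => X - C a).union (hA.image fun a => C a - X)).union
    (((hA.prod hA).image fun p : F × F => (X - C p.1) * (X - C p.2)).union (finite_singleton 1))) ?_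
  rintro g (⟨a, ha, -, rfl⟩ | ⟨a, ha, -, rfl⟩ | ⟨a, b, ha, hb, -, -, rfl⟩ | ⟨-, rfl⟩)
  · exact Or.inl (Or.inl ⟨a, ha, rfl⟩)
  · exact Or.inl (Or.inr ⟨a, ha, rfl⟩)
  · exact Or.inr (Or.inl ⟨(a, b), ⟨ha, hb⟩, rfl⟩)
  · exact Or.inr (Or.inr rfl)

namespace IsIntervalUnion

theorem isCompact (hK : IsIntervalUnion F K) : IsCompact K :=
  isCompact_Icc.of_isClosed_subset hK.isClosed hK.subset_Icc

theorem zero_mem_frontier (hK : IsIntervalUnion F K) : (0 : ℝ) ∈ frontier K := by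
  obtain ⟨b, hb, hb0, hb1, -⟩ := exists_frontier_gt (y := -1) hK.isClosed hK.zero_mem (by norm_num)
    fun h => by linarith [(hK.subset_Icc h).1]
  have := (hK.subset_Icc (hK.isClosed.frontier_subset hb)).1
  rwa [le_antisymm hb0 this] at hb

theorem one_mem_frontier (hK : IsIntervalUnion F K) : (1 : ℝ) ∈ frontier K := by
  obtain ⟨b, hb, hb0, hb1, -⟩ := exists_frontier_lt (y := 2) hK.isClosed hK.one_mem (by norm_num)
    fun h => by linarith [(hK.subset_Icc h).2]
  have := (hK.subset_Icc (hK.isClosed.frontier_subset hb)).2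
  rwa [le_antisymm this hb0] at hb

theorem X_mem_naturalGenerators (hK : IsIntervalUnion F K) : X ∈ naturalGenerators F K := by
  refine Or.inl ⟨0, by simpa using hK.zero_mem_frontier, ?_, by simp⟩
  ext x
  simp only [ZeroMemClass.coe_zero, mem_inter_iff, mem_Iio, mem_empty_iff_false, iff_false, not_and]
  exact fun hx h => absurd (hK.subset_Icc h).1 (not_le.mpr hx)

theorem one_sub_X_mem_naturalGenerators (hK : IsIntervalUnion F K) :
    1 - X ∈ naturalGenerators F K := by
  refine Or.inr (Or.inl ⟨1, by simpa using hK.one_mem_frontier, ?_, by simp⟩)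
  ext x
  simp only [OneMemClass.coe_one, mem_inter_iff, mem_Ioi, mem_empty_iff_false, iff_false, not_and]
  exact fun hx h => absurd (hK.subset_Icc h).2 (not_le.mpr hx)

theorem mul_mem_naturalGenerators {a b : F} (ha : (a : ℝ) ∈ frontier K)
    (hb : (b : ℝ) ∈ frontier K) (hab : a ≠ b) (hgap : ∀ x ∈ K, 0 ≤ (x - a) * (x - b)) :
    (X - C a) * (X - C b) ∈ naturalGenerators F K := by
  have hne : (a : ℝ) ≠ b := fun h => hab (Subtype.ext h)
  refine Or.inr (Or.inr (Or.inl ?_))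
  rcases lt_or_gt_of_ne hne with h | h
  · refine ⟨a, b, ha, hb, h, ?_, rfl⟩
    ext x
    simp only [mem_inter_iff, mem_Ioo, mem_empty_iff_false, iff_false, not_and]
    exact fun hx hxK => by nlinarith [hgap x hxK, hx.1, hx.2]
  · refine ⟨b, a, hb, ha, h, ?_, mul_comm _ _⟩
    ext x
    simp only [mem_inter_iff, mem_Ioo, mem_empty_iff_false, iff_false, not_and]
    exact fun hx hxK => by nlinarith [hgap x hxK, hx.1, hx.2]

theorem exists_gap (hK : IsIntervalUnion F K) {y : ℝ} (hy : y ∈ Icc (0 : ℝ) 1) (hyK : y ∉ K) :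
    ∃ a ∈ frontier K, ∃ b ∈ frontier K, a < y ∧ y < b ∧ ∀ x ∈ K, 0 ≤ (x - a) * (x - b) := by
  obtain ⟨a, ha, -, hay, hle⟩ := exists_frontier_lt hK.isClosed hK.zero_mem hy.1 hyK
  obtain ⟨b, hb, -, hyb, hge⟩ := exists_frontier_gt hK.isClosed hK.one_mem hy.2 hyK
  refine ⟨a, ha, b, hb, hay, hyb, fun x hx => ?_⟩
  rcases lt_or_ge x y with h | h
  · nlinarith [hle x hx h]
  · have : y < x := lt_of_le_of_ne h fun h' => hyK (h' ▸ hx)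
    nlinarith [hge x hx this]

theorem eq_basicClosed (hK : IsIntervalUnion F K) :
    K = basicClosed F (naturalGenerators F K) := by
  refine Subset.antisymm (fun x hx g hg => naturalGenerators_subset_Pos F K hg x hx) fun x hx => ?_
  have h0 : 0 ≤ x := by simpa using hx _ hK.X_mem_naturalGenerators
  have h1 : x ≤ 1 := by simpa using hx _ hK.one_sub_X_mem_naturalGenerators
  by_contra hxK
  obtain ⟨a, ha, b, hb, hax, hxb, hgap⟩ := hK.exists_gap ⟨h0, h1⟩ hxK
  have hab : a ≠ b := (hax.trans hxb).ne
  have := hx _ (mul_mem_naturalGenerators (a := ⟨a, hK.frontier_subset ha⟩)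
    (b := ⟨b, hK.frontier_subset hb⟩) ha hb (by simpa using hab) hgap)
  rw [map_mul, aeval_X_sub_C_coe, aeval_X_sub_C_coe] at this
  simp only at this
  nlinarith

/-- The frontier is finite, so `z` is its only point in a small ball. A point of that ball missing
from `K` lies in a gap whose end towards `z` must be `z` itself. -/
theorem exists_gap_of_mem_frontier (hK : IsIntervalUnion F K) {z : ℝ} (hz : z ∈ frontier K)
    (h0 : z ≠ 0) (h1 : z ≠ 1) :
    ∃ e ∈ frontier K, e ≠ z ∧ ∀ x ∈ K, 0 ≤ (x - z) * (x - e) := by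
  have hzK := hK.isClosed.frontier_subset hz
  have hz0 : 0 < z := lt_of_le_of_ne (hK.subset_Icc hzK).1 (Ne.symm h0)
  have hz1 : z < 1 := lt_of_le_of_ne (hK.subset_Icc hzK).2 h1
  have hU : ((frontier K \ {z})ᶜ ∩ Ioo 0 1) ∈ 𝓝 z := by
    refine inter_mem ?_ (Ioo_mem_nhds hz0 hz1)
    exact (hK.finite_frontier.subset sdiff_subset).isClosed.isOpen_compl.mem_nhds (by simp)
  obtain ⟨ε, hε, hball⟩ := Metric.mem_nhds_iff.mp hU
  by_contra hcon
  push Not at hcon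
  refine hz.2 (mem_interior_iff_mem_nhds.mpr (Metric.mem_nhds_iff.mpr ⟨ε, hε, fun y hy => ?_⟩))
  by_contra hyK
  have hy' := hball hy
  obtain ⟨a, ha, b, hb, hay, hyb, hgap⟩ := hK.exists_gap ⟨hy'.2.1.le, hy'.2.2.le⟩ hyK
  have hiso : ∀ c ∈ frontier K, |c - z| < ε → c = z := by
    intro c hc hcz
    by_contra hne
    exact (hball (show c ∈ Metric.ball z ε by rwa [Metric.mem_ball, Real.dist_eq])).1 ⟨hc, hne⟩
  rw [Metric.mem_ball, Real.dist_eq, abs_lt] at hy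
  have hzgap := hgap z hzK
  rcases lt_trichotomy y z with h | h | h
  · have hbz : b ≤ z := by nlinarith
    have hb' : b = z := hiso b hb (abs_lt.mpr ⟨by linarith, by linarith⟩)
    obtain ⟨x, hx, hlt⟩ := hcon a ha (by linarith)
    have := hgap x hx
    rw [hb'] at this
    linarith
  · exact hyK (h ▸ hzK)
  · have hbz : z ≤ a := by nlinarith
    have ha' : a = z := hiso a ha (abs_lt.mpr ⟨by linarith, by linarith⟩)
    obtain ⟨x, hx, hlt⟩ := hcon b hb (by linarith)
    have := hgap x hx
    rw [ha'] at this
    linarith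

end IsIntervalUnion

/-! ### Saturation: dividing out zeros -/

/-- This licenses cancelling a nonnegative factor `r`: its zeros are finite in number and `K` has no
isolated points, so continuity recovers the sign at them. -/
theorem aeval_nonneg_of_preperfect (hK : Preperfect K) {r f : F[X]} (hr : r ≠ 0)
    (h : ∀ x ∈ K, aeval x r ≠ 0 → 0 ≤ aeval x f) {x : ℝ} (hx : x ∈ K) : 0 ≤ aeval x f := by
  by_contra hneg
  have h1 : ∀ᶠ y in 𝓝 x, aeval y f < 0 :=
    (Polynomial.continuous_aeval f).continuousAt.eventually (gt_mem_nhds (not_le.mp hneg))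
  have h2 : (r.rootSet ℝ \ {x})ᶜ ∈ 𝓝 x :=
    ((r.rootSet_finite ℝ).subset sdiff_subset).isClosed.isOpen_compl.mem_nhds (by simp)
  obtain ⟨y, ⟨hyx, hyK⟩, hy1, hy2⟩ :=
    ((accPt_iff_frequently.mp (hK x hx)).and_eventually (h1.and h2)).exists
  refine absurd (h y hyK fun h0 => hy2 ⟨?_, hyx⟩) (not_le.mpr hy1)
  exact mem_rootSet.mpr ⟨hr, h0⟩

/-- An irreducible factor that vanishes at `z` of a polynomial nonnegative near `z` is repeated. -/
theorem dvd_of_nonneg_near {z : ℝ} {p q : F[X]} (hp : p = minpoly F z) (hz : IsAlgebraic F z)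
    (h : ∀ᶠ x in 𝓝 z, 0 ≤ aeval x (p * q)) : p ∣ q := by
  subst hp
  by_contra hndvd
  have hpz : aeval z (minpoly F z) = 0 := minpoly.aeval F z
  have hqz : aeval z q ≠ 0 := fun h0 => hndvd (minpoly.dvd F z h0)
  -- The product vanishes at `z`, so `z` is a local minimum and the derivative there, `p'(z) q(z)`,
  -- is zero; separability gives `p'(z) ≠ 0`.
  have hmin : IsLocalMin (fun x : ℝ => aeval x (minpoly F z * q)) z := by
    filter_upwards [h] with x hx
    simpa [hpz] using hx
  have hd := (Polynomial.hasDerivAt_aeval (minpoly F z * q) z).deriv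
  rw [hmin.deriv_eq_zero, derivative_mul, map_add, map_mul, map_mul, hpz, zero_mul,
    add_zero] at hd
  have hsep : (minpoly F z).Separable := (minpoly.irreducible hz.isIntegral).separable
  exact (mul_ne_zero (hsep.aeval_derivative_ne_zero hpz) hqz) hd.symm

theorem aeval_coe_eq_eval (f : F[X]) (c : F) : aeval (c : ℝ) f = (f.eval c : F) :=
  aeval_algebraMap_apply_eq_algebraMap_eval (A := ℝ) c f

theorem exists_eq_X_sub_C_mul {f : F[X]} {a : F} (h : aeval (a : ℝ) f = 0) :
    ∃ g, f = (X - C a) * g := by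
  rw [aeval_coe_eq_eval] at h
  exact dvd_iff_isRoot.mpr (Subtype.ext h)

/-- A power of `1 - (x - c)²` peaks at `c` and is uniformly small on `K`, which stays at positive
distance from `c`. -/
theorem exists_sq_lt {f : F[X]} {c : F} (hK : IsCompact K) (hK1 : K ⊆ Icc 0 1)
    (h0 : (0 : ℝ) ∈ K) (hc : (c : ℝ) ∈ Icc (0 : ℝ) 1) (hcK : (c : ℝ) ∉ K) {ε : ℝ} (hε : 0 < ε) :
    ∃ ψ : F[X], aeval (c : ℝ) ψ = 1 ∧ ∀ x ∈ K, aeval x f * aeval x ψ ^ 2 < ε := by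
  obtain ⟨δ, hδ, hle⟩ := exists_pos_forall_le_of_isCompact hK (f := fun x => (x - c) ^ 2)
    (by fun_prop) fun x hx => by
      have : x - c ≠ 0 := sub_ne_zero.mpr fun h => hcK (h ▸ hx)
      positivity
  obtain ⟨M, hM⟩ := hK.exists_bound_of_continuousOn (Polynomial.continuous_aeval f).continuousOn
  have hM0 : 0 ≤ M := (norm_nonneg _).trans (hM 0 h0)
  have hsq : ∀ x ∈ K, (x - c) ^ 2 ≤ 1 := by
    intro x hx
    have := hK1 hx
    have h1 : |x - c| ≤ 1 := abs_le.mpr ⟨by linarith [this.1, hc.2], by linarith [this.2, hc.1]⟩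
    rwa [sq_le_one_iff_abs_le_one]
  have hδ1 : 0 ≤ 1 - δ := by linarith [hle 0 h0, hsq 0 h0]
  obtain ⟨N, hN⟩ := exists_pow_lt_of_lt_one (show 0 < ε / (M + 1) by positivity)
    (show 1 - δ < 1 by linarith)
  refine ⟨(1 - (X - C c) ^ 2) ^ N, by
    simp only [map_pow, map_sub, map_one, aeval_X, aeval_C_coe, sub_self]; norm_num, fun x hx => ?_⟩
  rw [map_pow, map_sub, map_one, map_pow, aeval_X_sub_C_coe]
  have h1 : 0 ≤ 1 - (x - c) ^ 2 := by linarith [hsq x hx]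
  have h2 : 1 - (x - c) ^ 2 ≤ 1 - δ := by linarith [hle x hx]
  have h3 : (1 - (x - c) ^ 2) ^ N ≤ (1 - δ) ^ N := pow_le_pow_left₀ h1 h2 N
  have h4 : (1 - (x - c) ^ 2) ^ N ≤ 1 := pow_le_one₀ h1 (by linarith)
  have h5 : 0 ≤ (1 - (x - c) ^ 2) ^ N := pow_nonneg h1 N
  have h6 : aeval x f ≤ M := (le_abs_self _).trans (hM x hx)
  have h7 : ((1 - (x - c) ^ 2) ^ N) ^ 2 ≤ (1 - δ) ^ N := by nlinarith
  rw [lt_div_iff₀ (by positivity)] at hN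
  calc aeval x f * ((1 - (x - c) ^ 2) ^ N) ^ 2
      ≤ (M + 1) * ((1 - (x - c) ^ 2) ^ N) ^ 2 := by gcongr; linarith
    _ ≤ (M + 1) * (1 - δ) ^ N := by gcongr
    _ < ε := by linarith

namespace IsIntervalUnion

theorem mem_preordering_of_pos (hK : IsIntervalUnion F K) {q : F[X]}
    (hq : ∀ x ∈ K, 0 < aeval x q) : q ∈ preordering F (naturalGenerators F K) := by
  refine RealPos.mem_preordering_of_pos (finite_naturalGenerators hK.finite_frontier)
    (mem_preordering_of_mem hK.X_mem_naturalGenerators)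
    (mem_preordering_of_mem hK.one_sub_X_mem_naturalGenerators) ?_
  rwa [← hK.eq_basicClosed]

/-- A zero `a` at the end of a gap `(a, b)` can be removed if the other end `b` is not a zero. -/
theorem exists_decomposition (hK : IsIntervalUnion F K) {a b : F} {Z w : F[X]}
    (ha : (a : ℝ) ∈ frontier K) (hb : (b : ℝ) ∈ frontier K) (hab : a ≠ b)
    (hgap : ∀ x ∈ K, 0 ≤ (x - a) * (x - b)) (hw : ∀ x ∈ K, aeval x w ≠ 0)
    (hpos : ∀ x ∈ K, 0 ≤ aeval x ((X - C a) * Z * w)) (hfb : 0 < aeval (b : ℝ) ((X - C a) * Z * w)) :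
    ∃ w' : F[X], (∀ x ∈ K, aeval x w' ≠ 0) ∧ (∀ x ∈ K, 0 ≤ aeval x (Z * w')) ∧
      (Z * w' ∈ preordering F (naturalGenerators F K) →
        (X - C a) * Z * w ∈ preordering F (naturalGenerators F K)) := by
  set f := (X - C a) * Z * w with hf
  have haK := hK.subset_Icc (hK.isClosed.frontier_subset ha)
  have hbK := hK.subset_Icc (hK.isClosed.frontier_subset hb)
  -- A rational `t` keeps `c = (1 - t) b + t a` in `F`; small `t` puts `c` in the gap so near `b`
  -- that `f(c) > 0`.
  obtain ⟨t, ht0, ht1, ht⟩ : ∃ t : ℚ, 0 < t ∧ t < 1 ∧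
      0 < aeval ((b : ℝ) + t * (a - b)) f := by
    have hcont : Continuous fun t : ℝ => aeval ((b : ℝ) + t * (a - b)) f :=
      (Polynomial.continuous_aeval f).comp (by fun_prop)
    have h1 : ∀ᶠ t : ℝ in 𝓝 0, 0 < aeval ((b : ℝ) + t * (a - b)) f :=
      hcont.continuousAt.eventually (lt_mem_nhds (by simpa using hfb))
    obtain ⟨ε, hε, hball⟩ := Metric.eventually_nhds_iff.mp h1
    obtain ⟨t, ht0, ht⟩ := exists_rat_btwn (show 0 < min ε 1 by positivity)
    refine ⟨t, by exact_mod_cast ht0, by exact_mod_cast ht.trans_le (min_le_right _ _), hball ?_⟩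
    rw [Real.dist_eq, sub_zero, abs_of_pos ht0]
    exact ht.trans_le (min_le_left _ _)
  have ht0' : (0 : ℝ) < t := by exact_mod_cast ht0
  have ht1' : (t : ℝ) < 1 := by exact_mod_cast ht1
  set c : F := b + t * (a - b) with hcdef
  have hc : (c : ℝ) = b + t * (a - b) := by rw [hcdef]; push_cast; rfl
  rw [← hc] at ht
  have hne : (a : ℝ) ≠ b := fun h => hab (Subtype.ext h)
  have hcI : (c : ℝ) ∈ Icc (0 : ℝ) 1 := by
    rw [hc]; constructor <;> nlinarith [haK.1, haK.2, hbK.1, hbK.2]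
  have hcK : (c : ℝ) ∉ K := by
    intro h
    have h1 := hgap _ h
    have h2 : ((c : ℝ) - a) * (c - b) = -(t * (1 - t) * (a - b) ^ 2) := by rw [hc]; ring
    have h3 : 0 < (t : ℝ) * (1 - t) * (a - b) ^ 2 := by
      have : (0 : ℝ) < 1 - t := by linarith
      have : (a : ℝ) - b ≠ 0 := sub_ne_zero.mpr hne
      positivity
    linarith
  obtain ⟨ψ, hψc, hψ⟩ := exists_sq_lt (f := f) hK.isCompact hK.subset_Icc hK.zero_mem hcI hcK ht
  -- With `κ = 1 / f(c)`, `1 - κ f ψ²` vanishes at `c`, hence equals `(X - c) u`, yet it is positive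
  -- on `K`.
  set κ : F := (f.eval c)⁻¹ with hκ
  have hκ' : (κ : ℝ) = (aeval (c : ℝ) f)⁻¹ := by rw [aeval_coe_eq_eval, hκ]; push_cast; rfl
  obtain ⟨u, hu⟩ : ∃ u, 1 - C κ * f * ψ ^ 2 = (X - C c) * u := by
    refine exists_eq_X_sub_C_mul ?_
    rw [map_sub, map_mul, map_mul, map_pow, hψc, aeval_C_coe, hκ', map_one,
      inv_mul_cancel₀ ht.ne']
    norm_num
  have hu0 : ∀ x ∈ K, 0 < aeval x ((X - C c) * u) := by
    intro x hx
    rw [← hu, map_sub, map_mul, map_mul, map_pow, aeval_C_coe, hκ', map_one, mul_assoc, sub_pos,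
      inv_mul_lt_one₀ ht]
    exact hψ x hx
  have hdec : f = (X - C a) * (X - C c) * (Z * (w * u)) + C κ * (f * ψ) ^ 2 := by
    have : f = f * ((X - C c) * u) + C κ * (f * ψ) ^ 2 := by rw [← hu]; ring
    conv_lhs => rw [this]
    rw [hf]; ring
  have hCt : (C ((1 - t : ℚ) : F) : F[X]) = 1 - C (t : F) := by push_cast; simp
  -- `X - c` is the convex combination of `X - b` and `X - a` with weights `1 - t` and `t`.
  have hac : (X - C a) * (X - C c) =
      C ((1 - t : ℚ) : F) * ((X - C a) * (X - C b)) + C (t : F) * (X - C a) ^ 2 := by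
    rw [hCt, hcdef]; simp only [C_add, C_mul, C_sub]; ring
  have hacT : (X - C a) * (X - C c) ∈ preordering F (naturalGenerators F K) := by
    rw [hac]
    refine add_mem (mul_mem_preordering (C_mem_preordering _ ?_) (mem_preordering_of_mem
      (mul_mem_naturalGenerators ha hb hab hgap))) (C_mul_sq_mem_preordering _ ?_ _)
    · push_cast; linarith
    · push_cast; exact ht0'.le
  refine ⟨w * u, fun x hx => ?_, fun x hx => ?_, fun hmem => ?_⟩
  · rw [map_mul]
    refine mul_ne_zero (hw x hx) fun h => ?_
    have := hu0 x hx
    rw [map_mul, h, mul_zero] at this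
    exact lt_irrefl _ this
  · refine aeval_nonneg_of_preperfect hK.preperfect (X_sub_C_ne_zero a) (fun y hy hya => ?_) hx
    rw [aeval_X_sub_C_coe] at hya
    have h1 : 0 ≤ aeval y ((X - C a) * (X - C c)) * aeval y (Z * (w * u)) := by
      have := mul_nonneg (hpos y hy) (hu0 y hy).le
      rw [← map_mul] at this ⊢
      have e : (X - C a) * (X - C c) * (Z * (w * u)) = f * ((X - C c) * u) := by rw [hf]; ring
      rwa [e]
    have h2 : 0 < aeval y ((X - C a) * (X - C c)) := by
      rw [map_mul, aeval_X_sub_C_coe, aeval_X_sub_C_coe, hc]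
      have h3 := mul_nonneg (show (0 : ℝ) ≤ 1 - t by linarith) (hgap y hy)
      have h4 : 0 < (t : ℝ) * (y - a) ^ 2 := by positivity
      nlinarith
    exact nonneg_of_mul_nonneg_right h1 h2
  · rw [hdec]
    refine add_mem (mul_mem_preordering hacT hmem) (C_mul_sq_mem_preordering _ ?_ _)
    rw [hκ']; exact (inv_pos.mpr ht).le

/-- Splitting off `w` lets the induction run on the degree of `Z` alone: removing a one-sided gap
zero may raise the total degree, but the new factors have no zeros on `K` and go into `w`. -/
theorem mul_mem_preordering_of_nonneg (hK : IsIntervalUnion F K) (n : ℕ) : ∀ Z w : F[X],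
    Z.natDegree = n → Z ≠ 0 → (∀ x ∈ K, aeval x w ≠ 0) → (∀ x ∈ K, 0 ≤ aeval x (Z * w)) →
    Z * w ∈ preordering F (naturalGenerators F K) := by
  induction n using Nat.strong_induction_on with
  | _ n ih =>
  intro Z w hn hZ hw hpos
  by_cases hzero : ∀ x ∈ K, aeval x Z ≠ 0
  · refine hK.mem_preordering_of_pos fun x hx => lt_of_le_of_ne (hpos x hx) ?_
    rw [map_mul]
    exact (mul_ne_zero (hzero x hx) (hw x hx)).symm
  push Not at hzero
  obtain ⟨z, hzK, hz⟩ := hzero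
  by_cases hzfr : z ∈ frontier K
  · obtain ⟨a, rfl⟩ : ∃ a : F, (a : ℝ) = z := ⟨⟨z, hK.frontier_subset hzfr⟩, rfl⟩
    obtain ⟨Z₁, rfl⟩ := exists_eq_X_sub_C_mul hz
    have hZ₁ : Z₁ ≠ 0 := right_ne_zero_of_mul hZ
    have hdeg : Z₁.natDegree < n := by
      rw [← hn, natDegree_mul (X_sub_C_ne_zero a) hZ₁, natDegree_X_sub_C]; omega
    by_cases h0 : (a : ℝ) = 0
    · have ha : a = 0 := Subtype.ext h0
      subst ha
      rw [mul_assoc] at hpos ⊢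
      refine mul_mem_preordering (by
        simpa using mem_preordering_of_mem hK.X_mem_naturalGenerators) (ih _ hdeg _ _ rfl hZ₁ hw ?_)
      intro x hx
      refine aeval_nonneg_of_preperfect hK.preperfect (X_sub_C_ne_zero 0) (fun y hy hy0 => ?_) hx
      have h1 := hpos y hy
      rw [map_mul] at h1
      refine nonneg_of_mul_nonneg_right h1 (lt_of_le_of_ne ?_ hy0.symm)
      simpa using (hK.subset_Icc hy).1
    by_cases h1 : (a : ℝ) = 1
    · have ha : a = 1 := Subtype.ext h1
      subst ha
      have e : (X - C 1) * Z₁ * w = (1 - X) * (-Z₁ * w) := by rw [C_1]; ring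
      rw [e] at hpos ⊢
      refine mul_mem_preordering (mem_preordering_of_mem hK.one_sub_X_mem_naturalGenerators)
        (ih _ hdeg _ _ (natDegree_neg _) (neg_ne_zero.mpr hZ₁) hw ?_)
      intro x hx
      refine aeval_nonneg_of_preperfect (r := 1 - X) hK.preperfect ?_ (fun y hy hy0 => ?_) hx
      · rw [← neg_sub, neg_ne_zero]; simpa using X_sub_C_ne_zero (1 : F)
      have h1 := hpos y hy
      rw [map_mul] at h1
      refine nonneg_of_mul_nonneg_right h1 (lt_of_le_of_ne ?_ hy0.symm)
      simpa using (hK.subset_Icc hy).2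
    obtain ⟨e, he, hea, hgap⟩ := hK.exists_gap_of_mem_frontier hzfr h0 h1
    obtain ⟨b, rfl⟩ : ∃ b : F, (b : ℝ) = e := ⟨⟨e, hK.frontier_subset he⟩, rfl⟩
    have hab : a ≠ b := fun h => hea (by rw [h])
    have hbK := hK.isClosed.frontier_subset he
    rcases (hpos b hbK).eq_or_lt with hb | hb
    · obtain ⟨Z₂, rfl⟩ : ∃ Z₂, Z₁ = (X - C b) * Z₂ := by
        refine exists_eq_X_sub_C_mul ?_
        rw [map_mul, map_mul, aeval_X_sub_C_coe] at hb
        rcases mul_eq_zero.mp hb.symm with h | h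
        · exact (mul_eq_zero.mp h).resolve_left (sub_ne_zero.mpr hea)
        · exact absurd h (hw b hbK)
      have hZ₂ : Z₂ ≠ 0 := right_ne_zero_of_mul hZ₁
      have hdeg₂ : Z₂.natDegree < n := by
        refine lt_of_le_of_lt ?_ hdeg
        rw [natDegree_mul (X_sub_C_ne_zero b) hZ₂]; omega
      have e : (X - C a) * ((X - C b) * Z₂) * w = ((X - C a) * (X - C b)) * (Z₂ * w) := by ring
      rw [e] at hpos ⊢
      refine mul_mem_preordering (mem_preordering_of_mem
        (mul_mem_naturalGenerators hzfr he hab hgap)) (ih _ hdeg₂ _ _ rfl hZ₂ hw ?_)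
      intro x hx
      refine aeval_nonneg_of_preperfect hK.preperfect
        (mul_ne_zero (X_sub_C_ne_zero a) (X_sub_C_ne_zero b)) (fun y hy hy0 => ?_) hx
      have h1 := hpos y hy
      rw [map_mul] at h1
      refine nonneg_of_mul_nonneg_right h1 (lt_of_le_of_ne ?_ hy0.symm)
      rw [map_mul, aeval_X_sub_C_coe, aeval_X_sub_C_coe]
      exact hgap y hy
    · obtain ⟨w', hw', hpos', himp⟩ := hK.exists_decomposition hzfr he hab hgap hw hpos hb
      exact himp (ih _ hdeg _ _ rfl hZ₁ hw' hpos')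
  · have hzint : z ∈ interior K := by
      by_contra h
      exact hzfr ⟨subset_closure hzK, h⟩
    -- An interior zero need not lie in `F`, so its minimal polynomial is the factor to remove, with
    -- multiplicity two.
    have halg : IsAlgebraic F z := ⟨Z, hZ, hz⟩
    obtain ⟨Z₁, hZ₁⟩ := minpoly.dvd F z hz
    obtain ⟨q, hq⟩ := dvd_of_nonneg_near (q := Z₁ * w) rfl halg (by
      filter_upwards [mem_interior_iff_mem_nhds.mp hzint] with x hx
      rw [← mul_assoc, ← hZ₁]; exact hpos x hx)
    have hpz := minpoly.aeval F z
    have hZ₁z : aeval z Z₁ = 0 := by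
      have := congrArg (aeval z) hq
      rw [map_mul, map_mul, hpz, zero_mul] at this
      exact (mul_eq_zero.mp this).resolve_right (hw z hzK)
    obtain ⟨Z₂, hZ₂⟩ := minpoly.dvd F z hZ₁z
    have hpdeg : 0 < (minpoly F z).natDegree := minpoly.natDegree_pos halg.isIntegral
    rw [hZ₂] at hZ₁
    have hZ₂0 : Z₂ ≠ 0 := by rintro rfl; simp [hZ₁] at hZ
    have hp0 : minpoly F z ≠ 0 := minpoly.ne_zero halg.isIntegral
    have hdeg : Z₂.natDegree < n := by
      rw [← hn, hZ₁, natDegree_mul hp0 (mul_ne_zero hp0 hZ₂0), natDegree_mul hp0 hZ₂0]; omega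
    have e : Z * w = minpoly F z ^ 2 * (Z₂ * w) := by rw [hZ₁]; ring
    rw [e] at hpos ⊢
    refine mul_mem_preordering (sq_mem_preordering _ _) (ih _ hdeg _ _ rfl hZ₂0 hw ?_)
    intro x hx
    refine aeval_nonneg_of_preperfect hK.preperfect hp0 (fun y hy hy0 => ?_) hx
    have h1 := hpos y hy
    rw [map_mul, map_pow] at h1
    exact nonneg_of_mul_nonneg_right h1 (by positivity)

/-- The preordering generated by the natural generators of `K` is saturated. -/
theorem preordering_naturalGenerators (hK : IsIntervalUnion F K) :
    (preordering F (naturalGenerators F K) : Set F[X]) = Pos F K := by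
  refine Subset.antisymm (preordering_subset_Pos (naturalGenerators_subset_Pos F K)) fun f hf => ?_
  rcases eq_or_ne f 0 with rfl | h0
  · exact (preordering F _).zero_mem
  · simpa using hK.mul_mem_preordering_of_nonneg _ f 1 rfl h0 (by simp) (fun x hx => by
      simpa using hf x hx)

end IsIntervalUnion

/-! ### Geometry of the sets `C_n` -/

theorem one_mem_preCantorSet (n : ℕ) : (1 : ℝ) ∈ preCantorSet n := by
  induction n with
  | zero => simp
  | succ n ih => exact Or.inr ⟨1, ih, by norm_num⟩

theorem one_mem_cantorSet : (1 : ℝ) ∈ cantorSet := mem_iInter.mpr one_mem_preCantorSet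

/-- The similarity `x ↦ x / 3` as a homeomorphism. -/
noncomputable def divThree : ℝ ≃ₜ ℝ := Homeomorph.mulRight₀ (3⁻¹ : ℝ) (by norm_num)

/-- The similarity `x ↦ (2 + x) / 3` as a homeomorphism. -/
noncomputable def twoAddDivThree : ℝ ≃ₜ ℝ := (Homeomorph.addLeft (2 : ℝ)).trans divThree

theorem preCantorSet_succ_eq (n : ℕ) :
    preCantorSet (n + 1) = divThree '' preCantorSet n ∪ twoAddDivThree '' preCantorSet n := rfl

theorem cantorSet_eq : cantorSet = divThree '' cantorSet ∪ twoAddDivThree '' cantorSet :=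
  cantorSet_eq_union_halves

theorem frontier_preCantorSet_succ_subset (n : ℕ) : frontier (preCantorSet (n + 1)) ⊆
    divThree '' frontier (preCantorSet n) ∪ twoAddDivThree '' frontier (preCantorSet n) := by
  rw [preCantorSet_succ_eq, divThree.image_frontier, twoAddDivThree.image_frontier]
  exact (frontier_union_subset _ _).trans
    (union_subset_union inter_subset_left inter_subset_right)

theorem frontier_preCantorSet_zero : frontier (preCantorSet 0) = {0, 1} := by
  rw [preCantorSet_zero, frontier_Icc zero_le_one]

theorem finite_frontier_preCantorSet (n : ℕ) : (frontier (preCantorSet n)).Finite := by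
  induction n with
  | zero => rw [frontier_preCantorSet_zero]; exact toFinite _
  | succ n ih =>
    exact ((ih.image _).union (ih.image _)).subset (frontier_preCantorSet_succ_subset n)

theorem frontier_preCantorSet_subset_subfield (F : Subfield ℝ) (n : ℕ) :
    frontier (preCantorSet n) ⊆ (F : Set ℝ) := by
  induction n with
  | zero =>
    rw [frontier_preCantorSet_zero]
    rintro x (rfl | rfl)
    exacts [F.zero_mem, F.one_mem]
  | succ n ih =>
    have h2 : (2 : ℝ) ∈ F := ofNat_mem F 2
    have h3 : (3 : ℝ) ∈ F := ofNat_mem F 3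
    refine (frontier_preCantorSet_succ_subset n).trans (union_subset ?_ ?_)
    · rintro _ ⟨x, hx, rfl⟩
      exact F.mul_mem (ih hx) (F.inv_mem h3)
    · rintro _ ⟨x, hx, rfl⟩
      exact F.mul_mem (F.add_mem h2 (ih hx)) (F.inv_mem h3)

theorem frontier_preCantorSet_subset_cantorSet (n : ℕ) : frontier (preCantorSet n) ⊆ cantorSet := by
  induction n with
  | zero =>
    rw [frontier_preCantorSet_zero]
    rintro x (rfl | rfl)
    exacts [zero_mem_cantorSet, one_mem_cantorSet]
  | succ n ih =>
    rw [cantorSet_eq]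
    exact (frontier_preCantorSet_succ_subset n).trans
      (union_subset_union (image_mono ih) (image_mono ih))

/-- Source of the absence of isolated points: unlike finiteness of the frontier, this property
passes easily through images and unions. -/
theorem preCantorSet_subset_closure_interior (n : ℕ) :
    preCantorSet n ⊆ closure (interior (preCantorSet n)) := by
  induction n with
  | zero => rw [preCantorSet_zero, interior_Icc, closure_Ioo zero_ne_one]
  | succ n ih =>
    rw [preCantorSet_succ_eq]
    refine union_subset ?_ ?_
    · refine (image_mono ih).trans ?_
      rw [divThree.image_closure, divThree.image_interior]
      exact closure_mono (interior_mono subset_union_left)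
    · refine (image_mono ih).trans ?_
      rw [twoAddDivThree.image_closure, twoAddDivThree.image_interior]
      exact closure_mono (interior_mono subset_union_right)

theorem preperfect_of_subset_closure_interior {K : Set ℝ} (hK : IsClosed K)
    (h : K ⊆ closure (interior K)) :
    Preperfect K := by
  have h1 : Preperfect (interior K) := isOpen_interior.preperfect
  intro x hx
  exact (h1.perfect_closure.acc x (h hx)).mono
    (principal_mono.mpr (closure_minimal interior_subset hK))

theorem isIntervalUnion_preCantorSet (F : Subfield ℝ) (n : ℕ) :
    IsIntervalUnion F (preCantorSet n) where
  isClosed := isClosed_preCantorSet n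
  subset_Icc := preCantorSet_subset_unitInterval
  zero_mem := zero_mem_preCantorSet n
  one_mem := one_mem_preCantorSet n
  finite_frontier := finite_frontier_preCantorSet n
  frontier_subset := frontier_preCantorSet_subset_subfield F n
  preperfect := preperfect_of_subset_closure_interior (isClosed_preCantorSet n)
    (preCantorSet_subset_closure_interior n)

theorem not_preCantorSet_subset_succ (n : ℕ) : ¬ preCantorSet n ⊆ preCantorSet (n + 1) := by
  suffices h : ∃ x ∈ preCantorSet n, x ∉ preCantorSet (n + 1) by
    obtain ⟨x, hx, hx'⟩ := h
    exact fun hsub => hx' (hsub hx)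
  induction n with
  | zero =>
    -- The witness is the centre of the first removed interval; later ones are its images under `x ↦
    -- x / 3`.
    refine ⟨1 / 2, by norm_num, ?_⟩
    rw [preCantorSet_succ, preCantorSet_zero]
    rintro (⟨x, hx, h⟩ | ⟨x, hx, h⟩) <;> simp only at h <;> linarith [hx.1, hx.2]
  | succ n ih =>
    obtain ⟨x, hx, hx'⟩ := ih
    refine ⟨x / 3, Or.inl ⟨x, hx, rfl⟩, ?_⟩
    rw [preCantorSet_succ (n + 1)]
    rintro (⟨y, hy, h⟩ | ⟨y, hy, h⟩)
    · simp only at h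
      exact hx' ((show y = x by linarith) ▸ hy)
    · simp only at h
      linarith [(preCantorSet_subset_unitInterval hy).1, (preCantorSet_subset_unitInterval hx).2]

/-! ### From `C` to `C_n`, and failure of finite generation -/

theorem eventually_aeval_ne_zero {f : F[X]} (hf : f ≠ 0) (c : ℝ) :
    ∀ᶠ x in 𝓝[≠] c, aeval x f ≠ 0 := by
  have h2 : (f.rootSet ℝ \ {c})ᶜ ∈ 𝓝 c :=
    ((f.rootSet_finite ℝ).subset sdiff_subset).isClosed.isOpen_compl.mem_nhds (by simp)
  filter_upwards [mem_nhdsWithin_of_mem_nhds h2, self_mem_nhdsWithin] with x hx hxc h0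
  exact hx ⟨mem_rootSet.mpr ⟨hf, h0⟩, hxc⟩

/-- A nonzero polynomial has constant sign on a short interval on either side of a point. -/
theorem exists_sign_constant {f : F[X]} (hf : f ≠ 0) (c : ℝ) :
    ∃ ε > 0, ∀ x y : ℝ, 0 < |x - c| → |x - c| < ε → 0 < |y - c| → |y - c| < ε →
      0 < (x - c) * (y - c) → 0 < aeval y f → 0 ≤ aeval x f := by
  obtain ⟨ε, hε, h⟩ := Metric.eventually_nhds_iff.mp
    (eventually_nhdsWithin_iff.mp (eventually_aeval_ne_zero hf c))
  refine ⟨ε, hε, fun x y hx hxε hy hyε hxy hfy => ?_⟩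
  by_contra hneg
  obtain ⟨z, hz, hz0⟩ : (0 : ℝ) ∈ (fun x : ℝ => aeval x f) '' uIcc x y :=
    intermediate_value_uIcc (Polynomial.continuous_aeval f).continuousOn
      (mem_uIcc.mpr (Or.inl ⟨(not_le.mp hneg).le, hfy.le⟩))
  rw [abs_lt] at hxε hyε
  refine h (y := z) ?_ ?_ hz0
  · rw [Real.dist_eq, abs_lt]
    rcases mem_uIcc.mp hz with hz | hz <;> constructor <;> linarith [hz.1, hz.2]
  · rintro rfl
    rcases mem_uIcc.mp hz with hz | hz <;> nlinarith [hz.1, hz.2]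

/-- Each side of `c` is treated alone. A nearby point of `C` on that side fixes the sign of `f`;
without one, some `C_n` is empty on that side near `c`. -/
theorem exists_nhds_nonneg {f : F[X]} (hf : f ∈ Pos F cantorSet) {c : ℝ} (hc : c ∈ cantorSet) :
    ∃ n, ∃ V, IsOpen V ∧ c ∈ V ∧ ∀ x ∈ V ∩ preCantorSet n, 0 ≤ aeval x f := by
  rcases eq_or_ne f 0 with rfl | h0
  · exact ⟨0, univ, isOpen_univ, mem_univ _, by simp⟩
  obtain ⟨ε, hε, hnz⟩ := Metric.eventually_nhds_iff.mp
    (eventually_nhdsWithin_iff.mp (eventually_aeval_ne_zero h0 c))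
  obtain ⟨ε', hε', hsign⟩ := exists_sign_constant h0 c
  have hcn : ∀ n, c ∈ preCantorSet n := fun n => mem_iInter.mp hc n
  have hright : ∃ n, ∃ δ > 0, ∀ x ∈ preCantorSet n, c < x → x < c + δ → 0 ≤ aeval x f := by
    by_cases h : ∃ y ∈ cantorSet, c < y ∧ y < c + min ε ε'
    · obtain ⟨y, hy, hcy, hyδ⟩ := h
      have h1 := min_le_left ε ε'
      have h2 := min_le_right ε ε'
      have hfy : 0 < aeval y f := lt_of_le_of_ne (hf y hy) (hnz (by
        rw [Real.dist_eq, abs_lt]; constructor <;> linarith) hcy.ne').symm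
      -- Any level serves here, because the sign is constant on the whole one-sided interval.
      refine ⟨0, ε', hε', fun x _ hcx hxδ => hsign x y ?_ ?_ ?_ ?_ ?_ hfy⟩
      · exact abs_pos.mpr (by linarith)
      · rw [abs_lt]; constructor <;> linarith
      · exact abs_pos.mpr (by linarith)
      · rw [abs_lt]; constructor <;> linarith
      · exact mul_pos (by linarith) (by linarith)
    · push Not at h
      have hm : 0 < min ε ε' := lt_min hε hε'
      have hyC : c + min ε ε' / 2 ∉ cantorSet := fun hy => by
        linarith [h _ hy (by linarith)]
      obtain ⟨n, hn⟩ : ∃ n, c + min ε ε' / 2 ∉ preCantorSet n := by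
        by_contra hcon
        push Not at hcon
        exact hyC (mem_iInter.mpr hcon)
      -- `a` is the last point of `C_n` before the missing point. It belongs to `C`, so `a > c`
      -- would contradict `h`, and `C_n` has no points just right of `c`.
      obtain ⟨a, ha, hca, hay, hle⟩ := exists_frontier_lt (isClosed_preCantorSet n) (hcn n)
        (by linarith) hn
      refine ⟨n, min ε ε' / 2, by positivity, fun x hx hcx hxδ => ?_⟩
      have hxa := hle x hx hxδ
      have := h a (frontier_preCantorSet_subset_cantorSet n ha) (by linarith)
      linarith
  have hleft : ∃ n, ∃ δ > 0, ∀ x ∈ preCantorSet n, x < c → c - δ < x → 0 ≤ aeval x f := by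
    by_cases h : ∃ y ∈ cantorSet, y < c ∧ c - min ε ε' < y
    · obtain ⟨y, hy, hcy, hyδ⟩ := h
      have h1 := min_le_left ε ε'
      have h2 := min_le_right ε ε'
      have hfy : 0 < aeval y f := lt_of_le_of_ne (hf y hy) (hnz (by
        rw [Real.dist_eq, abs_lt]; constructor <;> linarith) hcy.ne).symm
      refine ⟨0, ε', hε', fun x _ hcx hxδ => hsign x y ?_ ?_ ?_ ?_ ?_ hfy⟩
      · exact abs_pos.mpr (by linarith)
      · rw [abs_lt]; constructor <;> linarith
      · exact abs_pos.mpr (by linarith)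
      · rw [abs_lt]; constructor <;> linarith
      · exact mul_pos_of_neg_of_neg (by linarith) (by linarith)
    · push Not at h
      have hm : 0 < min ε ε' := lt_min hε hε'
      have hyC : c - min ε ε' / 2 ∉ cantorSet := fun hy => by
        linarith [h _ hy (by linarith)]
      obtain ⟨n, hn⟩ : ∃ n, c - min ε ε' / 2 ∉ preCantorSet n := by
        by_contra hcon
        push Not at hcon
        exact hyC (mem_iInter.mpr hcon)
      obtain ⟨b, hb, hbc, hyb, hge⟩ := exists_frontier_gt (isClosed_preCantorSet n) (hcn n)
        (by linarith) hn
      refine ⟨n, min ε ε' / 2, by positivity, fun x hx hcx hxδ => ?_⟩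
      have hxb := hge x hx hxδ
      have := h b (frontier_preCantorSet_subset_cantorSet n hb) (by linarith)
      linarith
  obtain ⟨n, δ, hδ, hr⟩ := hright
  obtain ⟨m, δ', hδ', hl⟩ := hleft
  refine ⟨max n m, Ioo (c - δ') (c + δ), isOpen_Ioo, ⟨by linarith, by linarith⟩, ?_⟩
  rintro x ⟨hxV, hx⟩
  rcases lt_trichotomy x c with h | rfl | h
  · exact hl x (preCantorSet_antitone (le_max_right n m) hx) h hxV.1
  · exact hf x hc
  · exact hr x (preCantorSet_antitone (le_max_left n m) hx) h hxV.2

theorem Pos_cantorSet (F : Subfield ℝ) : Pos F cantorSet = ⋃ n : ℕ, Pos F (preCantorSet n) := by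
  refine Subset.antisymm (fun f hf => ?_) (iUnion_subset fun n f hf x hx =>
    hf x (mem_iInter.mp hx n))
  obtain ⟨n, V, hV, hCV, hpos⟩ : ∃ n, ∃ V, IsOpen V ∧ cantorSet ⊆ V ∧
      ∀ x ∈ V ∩ preCantorSet n, 0 ≤ aeval x f := by
    refine isCompact_cantorSet.induction_on (p := fun s => ∃ n, ∃ V, IsOpen V ∧ s ⊆ V ∧
      ∀ x ∈ V ∩ preCantorSet n, 0 ≤ aeval x f) ⟨0, ∅, isOpen_empty, Subset.rfl, by simp⟩ ?_ ?_ ?_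
    · rintro s t hst ⟨n, V, hV, htV, h⟩
      exact ⟨n, V, hV, hst.trans htV, h⟩
    · rintro s t ⟨n, V, hV, hsV, h⟩ ⟨m, W, hW, htW, h'⟩
      refine ⟨max n m, V ∪ W, hV.union hW, union_subset_union hsV htW, ?_⟩
      rintro x ⟨hx | hx, hxC⟩
      · exact h x ⟨hx, preCantorSet_antitone (le_max_left n m) hxC⟩
      · exact h' x ⟨hx, preCantorSet_antitone (le_max_right n m) hxC⟩
    · intro c hc
      obtain ⟨n, V, hV, hcV, h⟩ := exists_nhds_nonneg hf hc
      exact ⟨V, mem_nhdsWithin_of_mem_nhds (hV.mem_nhds hcV), n, V, hV, Subset.rfl, h⟩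
  -- The compact sets `C_n` decrease to `C`, so one of them already lies in the open set `V`.
  obtain ⟨m, hm⟩ := exists_subset_nhds_of_isCompact (V := preCantorSet)
    preCantorSet_antitone.directed_ge
    (fun n => isCompact_Icc.of_isClosed_subset (isClosed_preCantorSet n)
      preCantorSet_subset_unitInterval)
    (U := V) fun x hx => hV.mem_nhds (hCV hx)
  refine mem_iUnion.mpr ⟨max n m, fun x hx => hpos x ⟨hm ?_, ?_⟩⟩
  · exact preCantorSet_antitone (le_max_right n m) hx
  · exact preCantorSet_antitone (le_max_left n m) hx

theorem not_isFGPreordering_Pos_cantorSet (F : Subfield ℝ) :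
    ¬ IsFGPreordering F (Pos F cantorSet) := by
  rintro ⟨S, hS, hPS⟩
  have hmono : Monotone fun n => Pos F (preCantorSet n) :=
    fun m n hmn f hf x hx => hf x (preCantorSet_antitone hmn hx)
  have hSsub : S ⊆ ⋃ n, Pos F (preCantorSet n) := by
    rw [← Pos_cantorSet, hPS]
    exact fun g hg => mem_preordering_of_mem hg
  obtain ⟨I, hI, hSI⟩ := finite_subset_iUnion hS hSsub
  obtain ⟨N, hIN⟩ := hI.bddAbove
  have hN : S ⊆ Pos F (preCantorSet N) :=
    hSI.trans (iUnion₂_subset fun n hn => hmono (hIN hn))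
  -- `Pos(C_{N+1}) ⊆ Pos(C) = T_S ⊆ Pos(C_N)`. Applied to the natural generators of `C_{N+1}`, this
  -- forces the false inclusion `C_N ⊆ C_{N+1}`.
  have hsub : Pos F (preCantorSet (N + 1)) ⊆ Pos F (preCantorSet N) := by
    refine Subset.trans ?_ (preordering_subset_Pos hN)
    rw [← hPS, Pos_cantorSet]
    exact subset_iUnion (fun n => Pos F (preCantorSet n)) (N + 1)
  refine not_preCantorSet_subset_succ N fun x hx => ?_
  rw [(isIntervalUnion_preCantorSet F (N + 1)).eq_basicClosed]
  exact fun g hg => hsub (naturalGenerators_subset_Pos F _ hg) x hx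

end RealPos

/-- Here `preCantorSet n` is `C_n` and `cantorSet = ⋂ n, preCantorSet n` is `C`. The first conjunct
says that `C_n` is the basic closed semi-algebraic set given by its natural generators. -/
theorem theorem7p1 (F : Subfield ℝ) :
    (∀ n : ℕ, frontier (preCantorSet n) ⊆ (F : Set ℝ) ∧
      (RealPos.naturalGenerators F (preCantorSet n)).Finite ∧
      preCantorSet n = RealPos.basicClosed F (RealPos.naturalGenerators F (preCantorSet n))) ∧
    RealPos.Pos F cantorSet = ⋃ n : ℕ, RealPos.Pos F (preCantorSet n) ∧
    (⋃ n : ℕ, RealPos.Pos F (preCantorSet n)) =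
      ⋃ n : ℕ, (RealPos.preordering F
        (RealPos.naturalGenerators F (preCantorSet n)) : Set (Polynomial F)) ∧
    ¬ RealPos.IsFGPreordering F (RealPos.Pos F cantorSet) := by
  have h := RealPos.isIntervalUnion_preCantorSet F
  refine ⟨fun n => ⟨(h n).frontier_subset, RealPos.finite_naturalGenerators (h n).finite_frontier,
    (h n).eq_basicClosed⟩, RealPos.Pos_cantorSet F, ?_, RealPos.not_isFGPreordering_Pos_cantorSet F⟩
  exact Set.iUnion_congr fun n => (h n).preordering_naturalGenerators.symm
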